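/- **Setting.** Let $H$ be an $N$-dimensional complex vector space with a homogeneous basis $\phi_1,\dots,\phi_N$ of half-degrees $p_i=\tfrac12\deg\phi_i$, a non-degenerate symmetric pairing $(\cdot,\cdot)$ with $(\phi_i,\phi_j)=0$ unless $p_i+p_j=d$, a class $c_1\in H$ of half-degree $1$ and a class $1\in H$ of half-degree $0$. Put $\mu\phi_i=(p_i-\tfrac d2)\phi_i$ and $E=c_1+\sum_i(1-p_i)\tau^i\phi_i$ for $\tau=\sum_i\tau^i\phi_i$. Let $B\subset H$ be open and connected, and let $\star_\tau$ ($\tau\in B$) be a holomorphic family of products making $H$ a conformal Frobenius manifold over $B$: each $\star_\tau$ is commutative and associative with unit $1$ and satisfies $(a\star_\tau b,c)=(a,b\star_\tau c)$; moreover $\partial_a(b\star_\tau c)=\partial_b(a\star_\tau c)$, and $\star_\tau$ is homogeneous with respect to $E$. (For a Fano manifold $F$ one takes $H=H^{\rm even}(F;\mathbb C)$, the Poincaré pairing, $d=\dim F$, $c_1=c_1(F)$ and the big quantum product on a region $B$ where it converges.) The associated flat connection is $$\nabla_\alpha=\partial_\alpha+\tfrac1z(\alpha\star_\tau),\qquad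 \nabla_{z\partial_z}=z\partial_z-\tfrac1z(E\star_\tau)+\mu .$$ Suppose $\star_\tau$ is semisimple for $\tau\in B$. Let $\Psi_i=\psi_i/\sqrt{(\psi_i,\psi_i)}$ ($1\le i\le N$) be the normalized idempotents, where $\psi_1,\dots,\psi_N$ is a basis of $H$ with $\psi_i\star_\tau\psi_j=\delta_{ij}\psi_i$, chosen holomorphically in $\tau\in B$, and let $u_i=u_i(\tau)$ be given by $E\star_\tau\Psi_i=u_i\Psi_i$; the $u_i$ may coincide. Let $\tau_0\in B$ and let $\phi\in\mathbb R$ be admissible for $u_1(\tau_0),\dots,u_N(\tau_0)$, i.e. $e^{-\mathtt i\phi}(u_i(\tau_0)-u_j(\tau_0))\notin\mathbb R_{>0}$ for all $i,j$. Let $\epsilon>0$, and let $Y=(y_1,\dots,y_N)$ and $Y^-=(y_1^-,\dots,y_N^-)$ be asymptotically exponential fundamental solutions over $B$ associated to $e^{\mathtt i\phi}$ and $-e^{\mathtt i\phi}$: holomorphic frames of $\nabla$-flat sections, for $\tau\in B$ and $z$ in the sectors $|\arg z-\phi|<\frac\pi2+\epsilon$ and $|\arg z-\phi-\pi|<\frac\pi2+\epsilon$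 respectively, such that $e^{u_i/z}y_i(\tau,z)\to\Psi_i(\tau)$, respectively $e^{u_i/z}y_i^-(\tau,z)\to\Psi_i(\tau)$, as $z\to0$ in the sector, for every $\tau\in B$. Let $\Pi_\pm$ be the sectors $|\arg z-(\phi\pm\frac\pi2)|<\epsilon$, where the two sectors overlap. The Stokes matrices $S=(S_{ij})$ and $S_-=(S_{-,ij})$ are defined by $Y(z)=Y^-(z)S$ for $z\in\Pi_+$ and $Y(z)=Y^-(z)S_-$ for $z\in\Pi_-$ (where in the second formula the value of $Y^-$ at $z$ is taken at the argument $\arg z+2\pi$). **Proposition.** The Stokes matrices $S$, $S_-$ exist, are unique, and do not depend on $\tau\in B$. Moreover: 1. For $\tau\in B$ and $z\in\Pi_+$, $S_{ij}=S_{-,ji}=(y_i(\tau,e^{-\pi\mathtt i}z),y_j(\tau,z))$. The matrix $S$ is invertible, and $(S^{-1})_{ij}=(y^-_i(\tau,e^{\pi\mathtt i}z),y^-_j(\tau,z))$. 2. $S_{ii}=1$ for all $i$; $S_{ij}=0$ if $i\ne j$ and $u_i(\tau)=u_j(\tau)$ for some $\tau\in B$; and $S_{ij}=0$ if $\operatorname{Im}(e^{-\mathtt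 i\phi}u_i(\tau))<\operatorname{Im}(e^{-\mathtt i\phi}u_j(\tau))$ for some $\tau\in B$. In particular, if the indices are ordered so that $\operatorname{Im}(e^{-\mathtt i\phi}u_1(\tau_0))\ge\cdots\ge\operatorname{Im}(e^{-\mathtt i\phi}u_N(\tau_0))$, then $S$ is upper triangular with unit diagonal, i.e. $y_1,\dots,y_N$ are semiorthonormal for the pairing $[s,t)=(s(\tau,e^{-\pi\mathtt i}z),t(\tau,z))$, $z\in\Pi_+$: $[y_i,y_i)=1$ and $[y_i,y_j)=0$ for $i>j$. -/

import Mathlib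

open Filter Topology

noncomputable section

/-- The linear data underlying quantum cohomology: a finite-dimensional complex vector space
`H` (for a Fano manifold `F`, the even cohomology) with a homogeneous basis, half-degrees
(`halfDeg i = p` when the `i`-th basis vector lies in `H^{2p}`), the complex dimension `dim`,
the (Poincare) pairing, the first Chern class `c₁` and the identity class `one`. -/
structure GradedPairedSpace (N : ℕ) (H : Type*) [NormedAddCommGroup H] [NormedSpace ℂ H] where
  homBasis : Module.Basis (Fin N) ℂ H
  halfDeg : Fin N → ℂ
  dim : ℂ
  pairing : LinearMap.BilinForm ℂ H
  pairing_symm : ∀ a b, pairing a b = pairing b a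
  pairing_nondegenerate : ∀ a, (∀ b, pairing a b = 0) → a = 0
  pairing_homogeneous : ∀ i j, halfDeg i + halfDeg j ≠ dim →
    pairing (homBasis i) (homBasis j) = 0
  c₁ : H
  c₁_homogeneous : ∀ i, halfDeg i ≠ 1 → homBasis.repr c₁ i = 0
  one : H
  one_homogeneous : ∀ i, halfDeg i ≠ 0 → homBasis.repr one i = 0

namespace GradedPairedSpace

variable {N : ℕ} {H : Type*} [NormedAddCommGroup H] [NormedSpace ℂ H]

/-- Multiplication by the half-degree: `p` on `H^{2p}`. -/
def deg (G : GradedPairedSpace N H) : H →ₗ[ℂ] H :=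
  G.homBasis.constr ℂ fun i => G.halfDeg i • G.homBasis i

/-- The grading operator `μ`, equal to `p - dim / 2` on `H^{2p}`. -/
def mu (G : GradedPairedSpace N H) : H →ₗ[ℂ] H :=
  G.homBasis.constr ℂ fun i => (G.halfDeg i - G.dim / 2) • G.homBasis i

/-- The Euler vector field `E = c₁ + ∑ᵢ (1 - ½ deg φᵢ) τⁱ φᵢ`. -/
def euler (G : GradedPairedSpace N H) (τ : H) : H :=
  G.c₁ + ∑ i, ((1 - G.halfDeg i) * G.homBasis.repr τ i) • G.homBasis i

end GradedPairedSpace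

/-- A (conformal) Frobenius manifold structure, in flat coordinates, on the domain `B ⊆ H`:
a holomorphic family of products `⋆_τ`, `τ ∈ B`. The big quantum product of a Fano manifold on
a region where it converges is the motivating example. The axioms `integrable` and
`homogeneous` are the flatness of the big quantum connection. -/
structure FrobeniusManifold (N : ℕ) (H : Type*) [NormedAddCommGroup H] [NormedSpace ℂ H]
    (B : Set H) extends GradedPairedSpace N H where
  /-- `mul τ a b = a ⋆_τ b` -/
  mul : H → H →ₗ[ℂ] H →ₗ[ℂ] H
  mul_comm : ∀ τ ∈ B, ∀ a b, mul τ a b = mul τ b a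
  mul_assoc : ∀ τ ∈ B, ∀ a b c, mul τ (mul τ a b) c = mul τ a (mul τ b c)
  one_mul : ∀ τ ∈ B, ∀ a, mul τ one a = a
  pairing_mul : ∀ τ ∈ B, ∀ a b c, pairing (mul τ a b) c = pairing a (mul τ b c)
  mul_holomorphic : ∀ a b, DifferentiableOn ℂ (fun τ => mul τ a b) B
  /-- `∂_a (b ⋆_τ c) = ∂_b (a ⋆_τ c)` -/
  integrable : ∀ τ ∈ B, ∀ a b c,
    fderiv ℂ (fun σ => mul σ b c) τ a = fderiv ℂ (fun σ => mul σ a c) τ b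
  /-- The product is homogeneous of degree zero with respect to the Euler field. -/
  homogeneous : ∀ τ ∈ B, ∀ a b,
    fderiv ℂ (fun σ => mul σ a b) τ (toGradedPairedSpace.euler τ) =
      mul τ (toGradedPairedSpace.deg a) b + mul τ a (toGradedPairedSpace.deg b)
        - toGradedPairedSpace.deg (mul τ a b)

/-- Throughout, a point of the universal cover of `ℂ \ {0}` is given by its logarithm `w`, so
that `z = exp w`, `arg z = Im w`, `z ∂_z = ∂_w`, and `e^{-π i} z` is `w - π i`.
This is the sector `|arg z - φ| < π / 2 + ε`. -/
def logSector (φ ε : ℝ) : Set ℂ := {w | |w.im - φ| < Real.pi / 2 + ε}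

/-- The part `Π₊` of the overlap of the sectors of `Y` (around the phase `φ`) and of `Y⁻`
(around `φ + π`), in terms of the argument used for `Y`. -/
def piPlus (φ ε : ℝ) : Set ℂ := {w | |w.im - (φ + Real.pi / 2)| < ε}

/-- The part `Π₋` of the overlap of the two sectors, in terms of the argument used for `Y`. -/
def piMinus (φ ε : ℝ) : Set ℂ := {w | |w.im - (φ - Real.pi / 2)| < ε}

/-- The phase `φ` is admissible for `u₁, …, u_N`: `e^{-iφ}(uᵢ - uⱼ)` is never in `ℝ_{>0}`. -/
def IsAdmissible {N : ℕ} (φ : ℝ) (u : Fin N → ℂ) : Prop :=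
  ∀ i j, ∀ r : ℝ, 0 < r → Complex.exp (-(φ * Complex.I)) * (u i - u j) ≠ r

/-- `h_φ(u) = Im (e^{-iφ} u)`. -/
def height (φ : ℝ) (u : ℂ) : ℝ := (Complex.exp (-(φ * Complex.I)) * u).im

/-- Upper triangular with all diagonal entries equal to one. The Gram matrix of a
semiorthonormal collection is such. -/
def IsUniUpperTriangular {N : ℕ} (G : Matrix (Fin N) (Fin N) ℂ) : Prop :=
  (∀ i, G i i = 1) ∧ ∀ i j, j < i → G i j = 0

namespace FrobeniusManifold

variable {N : ℕ} {H : Type*} [NormedAddCommGroup H] [NormedSpace ℂ H] {B : Set H}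

/-- `Ψ₁, …, Ψ_N` are normalized idempotents of `⋆_τ`: there is a basis of orthogonal
idempotents `ψᵢ`, and `Ψᵢ = ψᵢ / √(ψᵢ, ψᵢ)` for some choices `cᵢ` of the square roots.
Such a basis exists exactly when `(H, ⋆_τ)` is semisimple. -/
def IsNormalizedIdempotents (Q : FrobeniusManifold N H B) (τ : H) (Ψ : Fin N → H) : Prop :=
  ∃ (ψ : Module.Basis (Fin N) ℂ H) (c : Fin N → ℂ),
    (∀ i j, Q.mul τ (ψ i) (ψ j) = if i = j then ψ i else 0) ∧
    (∀ i, c i ^ 2 = Q.pairing (ψ i) (ψ i)) ∧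
    ∀ i, Ψ i = (c i)⁻¹ • ψ i

/-- The big quantum connection in the direction `α`: `∇_α s = ∂_α s + z⁻¹ (α ⋆_τ s)`. -/
def nablaBase (Q : FrobeniusManifold N H B) (α : H) (s : H → ℂ → H) (τ : H) (w : ℂ) : H :=
  fderiv ℂ (fun σ => s σ w) τ α + (Complex.exp w)⁻¹ • Q.mul τ α (s τ w)

/-- The big quantum connection in the direction `z ∂_z`:
`∇_{z∂_z} s = z ∂_z s - z⁻¹ (E ⋆_τ s) + μ s`. -/
def nablaZ (Q : FrobeniusManifold N H B) (s : H → ℂ → H) (τ : H) (w : ℂ) : H :=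
  deriv (fun w' => s τ w') w
    - (Complex.exp w)⁻¹ • Q.mul τ (Q.toGradedPairedSpace.euler τ) (s τ w)
    + Q.toGradedPairedSpace.mu (s τ w)

/-- `Y = (y₁, …, y_N)` is an asymptotically exponential fundamental solution over `B`
associated to the phase `φ`, on the sector `|arg z - φ| < π / 2 + ε`: it is a holomorphic frame
of `∇`-flat sections, and `Y_τ(z) e^{U/z} → Ψ` as `z → 0` in the sector, for every `τ ∈ B`. -/
structure IsAsympExpSolution (Q : FrobeniusManifold N H B) (Ψ : Fin N → H → H)
    (u : Fin N → H → ℂ) (φ ε : ℝ) (Y : Fin N → H → ℂ → H) : Prop where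
  holomorphic : ∀ i, DifferentiableOn ℂ (fun p : H × ℂ => Y i p.1 p.2) (B ×ˢ logSector φ ε)
  flat_base : ∀ i, ∀ τ ∈ B, ∀ w ∈ logSector φ ε, ∀ α, Q.nablaBase α (Y i) τ w = 0
  flat_z : ∀ i, ∀ τ ∈ B, ∀ w ∈ logSector φ ε, Q.nablaZ (Y i) τ w = 0
  independent : ∀ τ ∈ B, ∀ w ∈ logSector φ ε, LinearIndependent ℂ fun i => Y i τ w
  asymptotic : ∀ τ ∈ B, ∀ i,
    Tendsto (fun w => Complex.exp (u i τ / Complex.exp w) • Y i τ w)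
      (comap Complex.exp (𝓝 0) ⊓ 𝓟 (logSector φ ε)) (𝓝 (Ψ i τ))

/-- The pairing `[s, t) = (s(τ, e^{-πi} z), t(τ, z))` of flat sections, evaluated at `z`. -/
def bracket (Q : FrobeniusManifold N H B) (s t : H → ℂ → H) (τ : H) (w : ℂ) : ℂ :=
  Q.pairing (s τ (w - Real.pi * Complex.I)) (t τ w)

end FrobeniusManifold

/-- `Y(z) = Y⁻(z) S` for `z ∈ Π₊`. -/
def IsStokesPlus {N : ℕ} {H : Type*} [NormedAddCommGroup H] [NormedSpace ℂ H] (φ ε : ℝ)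
    (Y Ym : Fin N → H → ℂ → H) (τ : H) (S : Matrix (Fin N) (Fin N) ℂ) : Prop :=
  ∀ w ∈ piPlus φ ε, ∀ j, Y j τ w = ∑ k, S k j • Ym k τ w

/-- `Y(z) = Y⁻(z) S₋` for `z ∈ Π₋`. The sector of `Y⁻` is centred at the phase `φ + π`, so a
point `z ∈ Π₋`, which has argument near `φ - π / 2` in the sector of `Y`, has argument
near `φ + 3π / 2` in the sector of `Y⁻`. -/
def IsStokesMinus {N : ℕ} {H : Type*} [NormedAddCommGroup H] [NormedSpace ℂ H] (φ ε : ℝ)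
    (Y Ym : Fin N → H → ℂ → H) (τ : H) (S : Matrix (Fin N) (Fin N) ℂ) : Prop :=
  ∀ w ∈ piMinus φ ε, ∀ j,
    Y j τ w = ∑ k, S k j • Ym k τ (w + 2 * Real.pi * Complex.I)

end

/-! The pairing of a flat section at `-z` with a flat section at `z` is constant in `τ` and `z`:
multiplication operators are self-adjoint and `1 / z` changes sign, so their contributions cancel,
while `μ` is skew-adjoint (`IsAsympExpSolution.pairing_const`). Let `z → 0` along a ray. The
constant `C`, times `exp ((uⱼ - uᵢ) / z)`, tends to `(Ψᵢ, Ψⱼ) = δᵢⱼ`. Hence `C = δᵢⱼ` if `uᵢ = uⱼ`,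
and `C = 0` if the exponential blows up on an available ray.

For `Y` against `Y⁻` all rays of a sector of opening larger than `π` are available, so one of these
cases always applies and the frames are dual (`IsAsympExpSolution.pairing_opposite`). The
coefficients of `yⱼ` in the frame `Y⁻` are therefore the numbers `[yᵢ, yⱼ)`; existence, uniqueness,
independence of `τ`, `S₋ = Sᵀ` and the inverse follow by linear algebra. For `Y` against itself, the
central ray of `Π₊` suffices: there the growth of the exponential is governed by the difference of
heights, which gives the vanishing in (2). -/

/-! ### Exponential growth along rays -/

open Complex in
/-- A sector of opening larger than `π` contains a direction in which `exp (a / z)` blows up. -/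
theorem exists_direction_re_pos {a : ℂ} (ha : a ≠ 0) (φ : ℝ) {ε : ℝ} (hε : 0 < ε) :
    ∃ θ : ℝ, |θ - φ| < Real.pi / 2 + ε ∧ 0 < (a * exp (-(θ * I))).re := by
  set b := a * exp (-(φ * I)) with hb
  have hb0 : b ≠ 0 := mul_ne_zero ha (exp_ne_zero _)
  have hpi := Real.pi_pos
  have key : ∀ δ : ℝ, (a * exp (-((φ + δ : ℝ) * I))).re
      = b.re * Real.cos δ + b.im * Real.sin δ := by
    intro δ
    have : exp (-((φ + δ : ℝ) * I)) = exp (-(φ * I)) * exp ((-δ : ℝ) * I) := by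
      rw [← exp_add]; push_cast; ring_nf
    rw [this, ← mul_assoc, ← hb, mul_re, exp_ofReal_mul_I_re, exp_ofReal_mul_I_im,
      Real.cos_neg, Real.sin_neg]
    ring
  have choose_shift : ∀ δ : ℝ, |δ| < Real.pi / 2 + ε →
      0 < b.re * Real.cos δ + b.im * Real.sin δ →
      ∃ θ : ℝ, |θ - φ| < Real.pi / 2 + ε ∧ 0 < (a * exp (-(θ * I))).re :=
    fun δ h1 h2 => ⟨φ + δ, by simpa using h1, by rw [key]; exact h2⟩
  rcases lt_trichotomy b.im 0 with h | h | h
  · refine choose_shift (-(Real.pi / 2)) ?_ ?_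
    · rw [abs_neg, abs_of_pos (by positivity)]; linarith
    · simpa using h
  · rcases lt_trichotomy b.re 0 with h' | h' | h'
    · set η := min (ε / 2) (Real.pi / 4)
      have h1 : 0 < η := lt_min (by positivity) (by positivity)
      have h2 : η ≤ ε / 2 := min_le_left _ _
      have h3 : η ≤ Real.pi / 4 := min_le_right _ _
      refine choose_shift (Real.pi / 2 + η) ?_ ?_
      · rw [abs_of_pos (by positivity)]; linarith
      · rw [h, zero_mul, add_zero]
        exact mul_pos_of_neg_of_neg h'
          (Real.cos_neg_of_pi_div_two_lt_of_lt (by linarith) (by linarith))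
    · exact absurd (Complex.ext h' h) hb0
    · refine choose_shift 0 ?_ (by simpa using h')
      rw [abs_zero]; positivity
  · refine choose_shift (Real.pi / 2) ?_ (by simpa using h)
    rw [abs_of_pos (by positivity)]; linarith

/-- The ray of argument `θ`, parametrized so that `z → 0` as `t → ∞`. -/
theorem tendsto_ray (φ ε θ : ℝ) (hθ : |θ - φ| < Real.pi / 2 + ε) :
    Tendsto (fun t : ℝ => -(t : ℂ) + θ * Complex.I) atTop
      (comap Complex.exp (𝓝 0) ⊓ 𝓟 (logSector φ ε)) := by
  refine tendsto_inf.2 ⟨tendsto_comap_iff.2 ?_,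
    tendsto_principal.2 (Eventually.of_forall fun t => ?_)⟩
  · rw [tendsto_zero_iff_norm_tendsto_zero]
    have : (fun t : ℝ => ‖(Complex.exp ∘ fun t : ℝ => -(t : ℂ) + θ * Complex.I) t‖)
        = fun t => Real.exp (-t) := by
      funext t
      simp [Complex.norm_exp]
    rw [this]
    exact Real.tendsto_exp_neg_atTop_nhds_zero
  · simpa [logSector] using hθ

/-- If `C exp (a / z)` stays bounded along a ray where `exp (a / z)` blows up, then `C = 0`. -/
theorem eq_zero_of_tendsto_mul_exp {C a l : ℂ} {θ : ℝ}
    (ha : 0 < (a * Complex.exp (-(θ * Complex.I))).re)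
    (h : Tendsto (fun t : ℝ => C * Complex.exp (a / Complex.exp (-(t : ℂ) + θ * Complex.I)))
      atTop (𝓝 l)) : C = 0 := by
  have h1 : Tendsto (fun t : ℝ =>
      (Complex.exp (a / Complex.exp (-(t : ℂ) + θ * Complex.I)))⁻¹) atTop (𝓝 0) := by
    rw [tendsto_zero_iff_norm_tendsto_zero]
    have : (fun t : ℝ => ‖(Complex.exp (a / Complex.exp (-(t : ℂ) + θ * Complex.I)))⁻¹‖)
        = fun t : ℝ => Real.exp (-((a * Complex.exp (-(θ * Complex.I))).re * Real.exp t)) := by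
      funext t
      rw [norm_inv, Complex.norm_exp, ← Real.exp_neg, div_eq_mul_inv, ← Complex.exp_neg,
        neg_add, neg_neg, Complex.exp_add, ← Complex.ofReal_exp, mul_left_comm,
        Complex.re_ofReal_mul, mul_comm (Real.exp t)]
    rw [this]
    exact Real.tendsto_exp_neg_atTop_nhds_zero.comp
      (Real.tendsto_exp_atTop.const_mul_atTop ha)
  have h2 := h.mul h1
  rw [mul_zero] at h2
  refine tendsto_nhds_unique (tendsto_const_nhds.congr fun t => ?_) h2
  rw [mul_assoc, mul_inv_cancel₀ (Complex.exp_ne_zero _), mul_one]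

/-! ### Sectors as strips in the logarithmic coordinate -/

theorem isOpen_strip (c r : ℝ) : IsOpen {w : ℂ | |w.im - c| < r} :=
  isOpen_lt (by fun_prop) continuous_const

theorem isPreconnected_strip (c r : ℝ) : IsPreconnected {w : ℂ | |w.im - c| < r} := by
  have : {w : ℂ | |w.im - c| < r} = Complex.imLm ⁻¹' Metric.ball c r := by
    ext w; simp [Real.dist_eq]
  rw [this]
  exact ((convex_ball c r).linear_preimage Complex.imLm).isPreconnected

/-! ### Linear algebra of the graded pairing -/

namespace GradedPairedSpace

variable {N : ℕ} {H : Type*} [NormedAddCommGroup H] [NormedSpace ℂ H]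

theorem finiteDimensional (G : GradedPairedSpace N H) : FiniteDimensional ℂ H :=
  Module.Finite.of_basis G.homBasis

/-- The grading operator is skew-adjoint. -/
theorem pairing_mu (G : GradedPairedSpace N H) (a b : H) :
    G.pairing (G.mu a) b = -G.pairing a (G.mu b) := by
  have : G.pairing.comp G.mu LinearMap.id = -G.pairing.comp LinearMap.id G.mu := by
    refine LinearMap.BilinForm.ext_basis G.homBasis fun i j => ?_
    simp only [LinearMap.BilinForm.comp_apply, LinearMap.id_apply, LinearMap.neg_apply, mu,
      Module.Basis.constr_basis, map_smul, LinearMap.smul_apply, smul_eq_mul]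
    -- If `pᵢ + pⱼ = d`, then `pᵢ - d / 2 = -(pⱼ - d / 2)`; otherwise both sides vanish.
    by_cases h : G.halfDeg i + G.halfDeg j = G.dim
    · rw [← h]; ring
    · rw [G.pairing_homogeneous i j h]; ring
  exact LinearMap.congr_fun₂ this a b

/-- Expansion of a vector in the basis dual to `x`. -/
theorem eq_sum_smul_iff (G : GradedPairedSpace N H) {x y : Fin N → H}
    (hx : LinearIndependent ℂ x) (hxy : ∀ i k, G.pairing (x i) (y k) = if i = k then 1 else 0)
    (v : H) (c : Fin N → ℂ) : v = ∑ k, c k • y k ↔ ∀ i, c i = G.pairing (x i) v := by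
  have hsum : ∀ i, G.pairing (x i) (∑ k, c k • y k) = c i := fun i => by
    simp [map_sum, hxy]
  constructor
  · rintro rfl i
    exact (hsum i).symm
  · intro h
    -- `N` independent vectors span the `N`-dimensional space, so a vector orthogonal to every `x i`
    -- is zero by non-degeneracy.
    have hspan : ⊤ ≤ Submodule.span ℂ (Set.range x) := by
      have := G.finiteDimensional
      refine (hx.span_eq_top_of_card_eq_finrank' ?_).ge
      rw [Module.finrank_eq_card_basis G.homBasis]
    refine sub_eq_zero.1 (G.pairing_nondegenerate _ fun b => ?_)
    rw [G.pairing_symm]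
    refine Submodule.span_induction (p := fun b _ => G.pairing b (v - ∑ k, c k • y k) = 0)
      ?_ (by simp) (fun p q _ _ hp hq => by rw [map_add, LinearMap.add_apply, hp, hq, add_zero])
      (fun r p _ hp => by rw [map_smul, LinearMap.smul_apply, hp, smul_zero])
      (hspan (Submodule.mem_top : b ∈ ⊤))
    rintro _ ⟨i, rfl⟩
    rw [map_sub, hsum, h, sub_self]

end GradedPairedSpace

namespace FrobeniusManifold

variable {N : ℕ} {H : Type*} [NormedAddCommGroup H] [NormedSpace ℂ H] {B : Set H}

theorem pairing_mul_left (Q : FrobeniusManifold N H B) {τ : H} (hτ : τ ∈ B) (a b c : H) :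
    Q.pairing (Q.mul τ a b) c = Q.pairing b (Q.mul τ a c) := by
  rw [Q.mul_comm τ hτ, Q.pairing_mul τ hτ]

/-- Normalized idempotents are orthonormal. -/
theorem IsNormalizedIdempotents.pairing_eq {Q : FrobeniusManifold N H B} {τ : H} (hτ : τ ∈ B)
    {Ψ : Fin N → H} (hΨ : Q.IsNormalizedIdempotents τ Ψ) (i j : Fin N) :
    Q.pairing (Ψ i) (Ψ j) = if i = j then 1 else 0 := by
  obtain ⟨ψ, c, hmul, hc, hΨ⟩ := hΨ
  have horth : ∀ i j, i ≠ j → Q.pairing (ψ i) (ψ j) = 0 := fun i j hij => by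
    have h := Q.pairing_mul τ hτ (ψ i) (ψ i) (ψ j)
    rw [hmul, hmul, if_pos rfl, if_neg hij, map_zero] at h
    exact h
  rw [hΨ, hΨ, map_smul, map_smul, LinearMap.smul_apply, smul_eq_mul, smul_eq_mul]
  split_ifs with hij
  · subst hij
    -- An isotropic `ψ i` would be orthogonal to the whole basis. Hence `c i ≠ 0`, and `(c i)⁻¹` is
    -- a genuine inverse.
    have hne : Q.pairing (ψ i) (ψ i) ≠ 0 := fun h0 => by
      refine ψ.ne_zero i (Q.pairing_nondegenerate _ fun b => ?_)
      have : Q.pairing (ψ i) = 0 := ψ.ext fun j => by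
        by_cases hij : i = j
        · subst hij; exact h0
        · exact horth i j hij
      rw [this, LinearMap.zero_apply]
    have hc0 : c i ≠ 0 := fun h0 => hne (by rw [← hc, h0]; ring)
    rw [← hc]
    field_simp
  · rw [horth i j hij, mul_zero, mul_zero]

/-! ### Flat sections and their pairings -/

section Solutions

variable {Q : FrobeniusManifold N H B} {Ψ : Fin N → H → H} {u : Fin N → H → ℂ}
  {φ₁ φ₂ ε₁ ε₂ : ℝ} {X Z : Fin N → H → ℂ → H}

theorem IsAsympExpSolution.hasFDerivAt_base (hX : Q.IsAsympExpSolution Ψ u φ₁ ε₁ X)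
    (hBo : IsOpen B) (i : Fin N) {τ : H} (hτ : τ ∈ B) {w : ℂ} (hw : w ∈ logSector φ₁ ε₁) :
    HasFDerivAt (fun σ => X i σ w) (fderiv ℂ (fun σ => X i σ w) τ) τ := by
  have h := (hX.holomorphic i).differentiableAt (x := (τ, w))
    ((hBo.prod (isOpen_strip _ _)).mem_nhds ⟨hτ, hw⟩)
  exact (h.comp (f := fun σ : H => (σ, w)) τ (by fun_prop)).hasFDerivAt

theorem IsAsympExpSolution.fderiv_base_apply (hX : Q.IsAsympExpSolution Ψ u φ₁ ε₁ X)
    (i : Fin N) {τ : H} (hτ : τ ∈ B) {w : ℂ} (hw : w ∈ logSector φ₁ ε₁) (α : H) :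
    fderiv ℂ (fun σ => X i σ w) τ α = -((Complex.exp w)⁻¹ • Q.mul τ α (X i τ w)) :=
  eq_neg_of_add_eq_zero_left (hX.flat_base i τ hτ w hw α)

theorem IsAsympExpSolution.hasDerivAt (hX : Q.IsAsympExpSolution Ψ u φ₁ ε₁ X)
    (hBo : IsOpen B) (i : Fin N) {τ : H} (hτ : τ ∈ B) {w : ℂ} (hw : w ∈ logSector φ₁ ε₁) :
    HasDerivAt (X i τ) ((Complex.exp w)⁻¹ • Q.mul τ (Q.euler τ) (X i τ w)
      - Q.mu (X i τ w)) w := by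
  have h := (hX.holomorphic i).differentiableAt (x := (τ, w))
    ((hBo.prod (isOpen_strip _ _)).mem_nhds ⟨hτ, hw⟩)
  have h' : DifferentiableAt ℂ (X i τ) w :=
    h.comp (f := fun w' : ℂ => (τ, w')) w (by fun_prop)
  have h0 : deriv (X i τ) w - (Complex.exp w)⁻¹ • Q.mul τ (Q.euler τ) (X i τ w)
      + Q.mu (X i τ w) = 0 := hX.flat_z i τ hτ w hw
  have e : deriv (X i τ) w = (Complex.exp w)⁻¹ • Q.mul τ (Q.euler τ) (X i τ w)
      - Q.mu (X i τ w) := by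
    rw [← sub_eq_zero, ← h0]; abel
  exact e ▸ h'.hasDerivAt

/-- The pairing of flat sections at `-z` and `z` is constant. -/
theorem IsAsympExpSolution.pairing_const (hX : Q.IsAsympExpSolution Ψ u φ₁ ε₁ X)
    (hZ : Q.IsAsympExpSolution Ψ u φ₂ ε₂ Z) (hBo : IsOpen B) (hBc : IsPreconnected B)
    {V : Set ℂ} (hVo : IsOpen V) (hVc : IsPreconnected V)
    (hV₁ : ∀ w ∈ V, w - Real.pi * Complex.I ∈ logSector φ₁ ε₁)
    (hV₂ : ∀ w ∈ V, w ∈ logSector φ₂ ε₂) (i j : Fin N)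
    {τ τ' : H} (hτ : τ ∈ B) (hτ' : τ' ∈ B) {w w' : ℂ} (hw : w ∈ V) (hw' : w' ∈ V) :
    Q.pairing (X i τ (w - Real.pi * Complex.I)) (Z j τ w) =
      Q.pairing (X i τ' (w' - Real.pi * Complex.I)) (Z j τ' w') := by
  have := Q.finiteDimensional
  -- This sign makes the two multiplication terms of each Leibniz rule below cancel.
  have hexp : ∀ w : ℂ, (Complex.exp (w - Real.pi * Complex.I))⁻¹ = -(Complex.exp w)⁻¹ :=
    fun w => by rw [Complex.exp_sub_pi_mul_I, inv_neg]
  let P := LinearMap.toContinuousBilinearMap Q.pairing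
  have base : ∀ σ ∈ B, HasFDerivAt
      (fun σ => P (X i σ (w - Real.pi * Complex.I)) (Z j σ w)) (0 : H →L[ℂ] ℂ) σ := by
    intro σ hσ
    have h := P.hasFDerivAt_of_bilinear
      (hX.hasFDerivAt_base hBo i hσ (hV₁ w hw)) (hZ.hasFDerivAt_base hBo j hσ (hV₂ w hw))
    refine h.congr_fderiv (ContinuousLinearMap.ext fun α => ?_)
    change Q.pairing (X i σ (w - Real.pi * Complex.I)) (fderiv ℂ (fun σ => Z j σ w) σ α)
      + Q.pairing (fderiv ℂ (fun σ => X i σ (w - Real.pi * Complex.I)) σ α) (Z j σ w) = 0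
    rw [hX.fderiv_base_apply i hσ (hV₁ w hw), hZ.fderiv_base_apply j hσ (hV₂ w hw), hexp]
    simp only [map_neg, map_smul, LinearMap.neg_apply, LinearMap.smul_apply, neg_smul,
      Q.pairing_mul_left hσ]
    ring
  have fibre : ∀ v ∈ V, HasDerivAt
      (fun v => P (X i τ' (v - Real.pi * Complex.I)) (Z j τ' v)) 0 v := by
    intro v hv
    have h1 := (hX.hasDerivAt hBo i hτ' (hV₁ v hv)).comp_sub_const v (Real.pi * Complex.I)
    have h := P.hasDerivAt_of_bilinear (fun _ => h1) (fun _ => hZ.hasDerivAt hBo j hτ' (hV₂ v hv))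
    refine h.congr_deriv ?_
    change Q.pairing (X i τ' (v - Real.pi * Complex.I)) _ + Q.pairing _ (Z j τ' v) = 0
    rw [hexp]
    simp only [map_sub, map_smul, LinearMap.sub_apply, LinearMap.smul_apply, neg_smul, map_neg,
      LinearMap.neg_apply, Q.pairing_mul_left hτ', Q.pairing_mu]
    ring
  -- Move from `τ` to `τ'` at fixed `w`, then from `w` to `w'` at fixed `τ'`.
  exact (hBo.is_const_of_fderiv_eq_zero hBc
      (fun σ hσ => (base σ hσ).differentiableAt.differentiableWithinAt)
      (fun σ hσ => (base σ hσ).fderiv) hτ hτ').trans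
    (hVo.is_const_of_deriv_eq_zero hVc
      (fun v hv => (fibre v hv).differentiableAt.differentiableWithinAt)
      (fun v hv => (fibre v hv).deriv) hw hw')

/-- The normalizing factors `exp (uᵢ / (-z))` and `exp (uⱼ / z)` of the two sections combine into
one exponential, and normalized idempotents are orthonormal. No constancy of the pairing is needed
here. -/
theorem IsAsympExpSolution.tendsto_pairing_mul_exp (hX : Q.IsAsympExpSolution Ψ u φ₁ ε₁ X)
    (hZ : Q.IsAsympExpSolution Ψ u φ₂ ε₂ Z) {τ : H} (hτ : τ ∈ B)
    (hΨ : Q.IsNormalizedIdempotents τ fun i => Ψ i τ) (i j : Fin N) {θ : ℝ}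
    (h₁ : |θ - Real.pi - φ₁| < Real.pi / 2 + ε₁) (h₂ : |θ - φ₂| < Real.pi / 2 + ε₂) :
    Tendsto (fun t : ℝ =>
      Q.pairing (X i τ (-(t : ℂ) + θ * Complex.I - Real.pi * Complex.I))
        (Z j τ (-(t : ℂ) + θ * Complex.I)) *
      Complex.exp ((u j τ - u i τ) / Complex.exp (-(t : ℂ) + θ * Complex.I)))
      atTop (𝓝 (if i = j then 1 else 0)) := by
  have := Q.finiteDimensional
  let P := LinearMap.toContinuousBilinearMap Q.pairing
  have hx := (hX.asymptotic τ hτ i).comp (tendsto_ray φ₁ ε₁ (θ - Real.pi) h₁)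
  have hz := (hZ.asymptotic τ hτ j).comp (tendsto_ray φ₂ ε₂ θ h₂)
  have hP := (P.isBoundedBilinearMap.continuous.tendsto (Ψ i τ, Ψ j τ)).comp (hx.prodMk_nhds hz)
  have e : P (Ψ i τ) (Ψ j τ) = if i = j then 1 else 0 := hΨ.pairing_eq hτ i j
  simp only [e] at hP
  refine hP.congr fun t => ?_
  have ew : -(t : ℂ) + ((θ - Real.pi : ℝ) : ℂ) * Complex.I
      = -(t : ℂ) + θ * Complex.I - Real.pi * Complex.I := by push_cast; ring
  simp only [Function.comp_apply, P, ew, LinearMap.toContinuousBilinearMap_apply, map_smul,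
    smul_eq_mul, Complex.exp_sub_pi_mul_I, sub_div,
    LinearMap.smul_apply]
  rw [div_neg, Complex.exp_sub, Complex.exp_neg]
  ring

/-- A pairing constant along a ray takes the value `δᵢⱼ` when `uᵢ = uⱼ`. -/
theorem IsAsympExpSolution.pairing_eq_of_eigenvalue_eq (hX : Q.IsAsympExpSolution Ψ u φ₁ ε₁ X)
    (hZ : Q.IsAsympExpSolution Ψ u φ₂ ε₂ Z) {τ : H} (hτ : τ ∈ B)
    (hΨ : Q.IsNormalizedIdempotents τ fun i => Ψ i τ) {i j : Fin N} {θ : ℝ}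
    (h₁ : |θ - Real.pi - φ₁| < Real.pi / 2 + ε₁) (h₂ : |θ - φ₂| < Real.pi / 2 + ε₂) {C : ℂ}
    (hC : ∀ t : ℝ, Q.pairing (X i τ (-(t : ℂ) + θ * Complex.I - Real.pi * Complex.I))
        (Z j τ (-(t : ℂ) + θ * Complex.I)) = C) (hu : u i τ = u j τ) :
    C = if i = j then 1 else 0 := by
  have h := hX.tendsto_pairing_mul_exp hZ hτ hΨ i j h₁ h₂
  simp only [hC, hu, sub_self, zero_div, Complex.exp_zero, mul_one] at h
  exact tendsto_nhds_unique tendsto_const_nhds h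

/-- A pairing constant along a ray vanishes when `exp ((uⱼ - uᵢ) / z)` blows up there. -/
theorem IsAsympExpSolution.pairing_eq_zero_of_re_pos (hX : Q.IsAsympExpSolution Ψ u φ₁ ε₁ X)
    (hZ : Q.IsAsympExpSolution Ψ u φ₂ ε₂ Z) {τ : H} (hτ : τ ∈ B)
    (hΨ : Q.IsNormalizedIdempotents τ fun i => Ψ i τ) {i j : Fin N} {θ : ℝ}
    (h₁ : |θ - Real.pi - φ₁| < Real.pi / 2 + ε₁) (h₂ : |θ - φ₂| < Real.pi / 2 + ε₂) {C : ℂ}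
    (hC : ∀ t : ℝ, Q.pairing (X i τ (-(t : ℂ) + θ * Complex.I - Real.pi * Complex.I))
        (Z j τ (-(t : ℂ) + θ * Complex.I)) = C)
    (hpos : 0 < ((u j τ - u i τ) * Complex.exp (-(θ * Complex.I))).re) : C = 0 := by
  have h := hX.tendsto_pairing_mul_exp hZ hτ hΨ i j h₁ h₂
  simp only [hC] at h
  exact eq_zero_of_tendsto_mul_exp hpos h

/-- The solutions associated to opposite phases are dual to each other. -/
theorem IsAsympExpSolution.pairing_opposite {φ ε : ℝ} {Y Ym : Fin N → H → ℂ → H}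
    (hY : Q.IsAsympExpSolution Ψ u φ ε Y) (hYm : Q.IsAsympExpSolution Ψ u (φ + Real.pi) ε Ym)
    (hBo : IsOpen B) (hBc : IsPreconnected B) (hε : 0 < ε)
    (hΨ : ∀ τ ∈ B, Q.IsNormalizedIdempotents τ fun i => Ψ i τ) {τ : H} (hτ : τ ∈ B)
    {w : ℂ} (hw : w ∈ logSector (φ + Real.pi) ε) (i j : Fin N) :
    Q.pairing (Y i τ (w - Real.pi * Complex.I)) (Ym j τ w) = if i = j then 1 else 0 := by
  have hpi := Real.pi_pos
  have hconst : ∀ w' ∈ logSector (φ + Real.pi) ε,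
      Q.pairing (Y i τ (w' - Real.pi * Complex.I)) (Ym j τ w') =
        Q.pairing (Y i τ (w - Real.pi * Complex.I)) (Ym j τ w) := fun w' hw' =>
    hY.pairing_const hYm hBo hBc (isOpen_strip _ _) (isPreconnected_strip _ _)
      (fun v hv => by
        simp only [logSector, Set.mem_ofPred_eq] at hv ⊢
        convert hv using 2; simp; ring)
      (fun _ hv => hv) i j hτ hτ hw' hw
  have hray : ∀ θ : ℝ, |θ - (φ + Real.pi)| < Real.pi / 2 + ε →
      |θ - Real.pi - φ| < Real.pi / 2 + ε ∧
      ∀ t : ℝ, Q.pairing (Y i τ (-(t : ℂ) + θ * Complex.I - Real.pi * Complex.I))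
        (Ym j τ (-(t : ℂ) + θ * Complex.I)) =
        Q.pairing (Y i τ (w - Real.pi * Complex.I)) (Ym j τ w) := fun θ hθ =>
    ⟨by rwa [sub_sub, add_comm Real.pi], fun t => hconst _ (by simpa [logSector] using hθ)⟩
  by_cases hu : u i τ = u j τ
  · have hθ : |φ + Real.pi - (φ + Real.pi)| < Real.pi / 2 + ε := by
      rw [sub_self, abs_zero]; positivity
    exact hY.pairing_eq_of_eigenvalue_eq hYm hτ (hΨ τ hτ) (hray _ hθ).1 hθ (hray _ hθ).2 hu
  · rw [if_neg (fun h => hu (by rw [h]))]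
    obtain ⟨θ, hθ, hpos⟩ :=
      exists_direction_re_pos (sub_ne_zero.2 (Ne.symm hu)) (φ + Real.pi) hε
    exact hY.pairing_eq_zero_of_re_pos hYm hτ (hΨ τ hτ) (hray _ hθ).1 hθ (hray _ hθ).2 hpos

end Solutions

end FrobeniusManifold

/-! ### Admissibility and the Stokes matrices -/

/-- Equal heights make `e^{-iφ}(uᵢ - uⱼ)` real; admissibility for `(i, j)` and for `(j, i)` excludes
both signs. -/
theorem eq_of_height_eq_of_isAdmissible {N : ℕ} {φ : ℝ} {u : Fin N → ℂ} (hφ : IsAdmissible φ u)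
    {i j : Fin N} (h : height φ (u i) = height φ (u j)) : u i = u j := by
  set e := Complex.exp (-(φ * Complex.I)) with he
  have hreal : ∀ i j, height φ (u i) = height φ (u j) →
      e * (u i - u j) = ((e * (u i - u j)).re : ℝ) := fun i j h => by
    apply Complex.ext
    · simp
    · rw [mul_sub, Complex.sub_im, Complex.ofReal_im]
      exact sub_eq_zero.2 h
  have hle : ∀ i j, height φ (u i) = height φ (u j) → (e * (u i - u j)).re ≤ 0 := fun i j h =>
    not_lt.1 fun hpos => hφ i j _ hpos (hreal i j h)
  have h1 := hle i j h
  have h2 := hle j i h.symm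
  have h0 : (e * (u i - u j)).re = 0 := by
    have : e * (u j - u i) = -(e * (u i - u j)) := by ring
    rw [this, Complex.neg_re] at h2
    linarith
  have h3 := hreal i j h
  rw [h0, Complex.ofReal_zero] at h3
  exact sub_eq_zero.1 ((mul_eq_zero.1 h3).resolve_left (Complex.exp_ne_zero _))

theorem proposition2p6 {N : ℕ} {H : Type*} [NormedAddCommGroup H] [NormedSpace ℂ H]
    {B : Set H} (hBo : IsOpen B) (hBc : IsPreconnected B)
    (Q : FrobeniusManifold N H B)
    -- normalized idempotents and eigenvalues of `E ⋆_τ`, depending holomorphically on `τ`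
    (Ψ : Fin N → H → H) (u : Fin N → H → ℂ)
    (hΨ : ∀ τ ∈ B, Q.IsNormalizedIdempotents τ fun i => Ψ i τ)
    (hΨh : ∀ i, DifferentiableOn ℂ (Ψ i) B)
    (hu : ∀ τ ∈ B, ∀ i,
      Q.mul τ (Q.toGradedPairedSpace.euler τ) (Ψ i τ) = u i τ • Ψ i τ)
    (τ₀ : H) (hτ₀ : τ₀ ∈ B) (φ : ℝ) (hφ : IsAdmissible φ fun i => u i τ₀)
    (ε : ℝ) (hε : 0 < ε)
    -- the solutions associated to `e^{iφ}` and to `-e^{iφ}`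
    (Y Ym : Fin N → H → ℂ → H)
    (hY : Q.IsAsympExpSolution Ψ u φ ε Y)
    (hYm : Q.IsAsympExpSolution Ψ u (φ + Real.pi) ε Ym) :
    ∃ S Sm : Matrix (Fin N) (Fin N) ℂ,
      -- for every `τ`, `S` and `Sm` are the Stokes matrices; they do not depend on `τ`
      (∀ τ ∈ B, ∀ T, IsStokesPlus φ ε Y Ym τ T ↔ T = S) ∧
      (∀ τ ∈ B, ∀ T, IsStokesMinus φ ε Y Ym τ T ↔ T = Sm) ∧
      -- (1)
      (∀ i j, S i j = Sm j i) ∧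
      (∀ τ ∈ B, ∀ w ∈ piPlus φ ε, ∀ i j, S i j = Q.bracket (Y i) (Y j) τ w) ∧
      IsUnit S ∧
      (∀ τ ∈ B, ∀ w ∈ piPlus φ ε, ∀ i j,
        S⁻¹ i j = Q.pairing (Ym i τ (w + Real.pi * Complex.I)) (Ym j τ w)) ∧
      -- (2)
      (∀ i, S i i = 1) ∧
      (∀ τ ∈ B, ∀ i j, i ≠ j → u i τ = u j τ → S i j = 0) ∧
      (∀ τ ∈ B, ∀ i j, height φ (u i τ) < height φ (u j τ) → S i j = 0) ∧
      -- triangularity and semiorthonormality for the orderings by decreasing height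
      (∀ σ : Equiv.Perm (Fin N), Antitone (fun k => height φ (u (σ k) τ₀)) →
        IsUniUpperTriangular (S.submatrix σ σ) ∧
        ∀ τ ∈ B, ∀ w ∈ piPlus φ ε, IsUniUpperTriangular
          (Matrix.of fun k l => Q.bracket (Y (σ k)) (Y (σ l)) τ w)) := by
  have hpi := Real.pi_pos
  have sec : ∀ {w : ℂ} {c r : ℝ}, |w.im - c| < r ↔ c - r < w.im ∧ w.im < c + r := fun {w c r} => by
    rw [abs_lt]; constructor <;> rintro ⟨h, h'⟩ <;> constructor <;> linarith
  -- positions of the shifted points relative to the two sectors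
  have plus_Y : ∀ w ∈ piPlus φ ε, w ∈ logSector φ ε := fun w hw => by
    simp only [piPlus, logSector, Set.mem_ofPred_eq, sec] at hw ⊢
    constructor <;> linarith
  have plus_sub : ∀ w ∈ piPlus φ ε, w - Real.pi * Complex.I ∈ logSector φ ε := fun w hw => by
    simp only [piPlus, logSector, Set.mem_ofPred_eq, sec] at hw ⊢
    simp
    constructor <;> linarith
  have plus_Ym : ∀ w ∈ piPlus φ ε, w ∈ logSector (φ + Real.pi) ε := fun w hw => by
    simp only [piPlus, logSector, Set.mem_ofPred_eq, sec] at hw ⊢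
    constructor <;> linarith
  have plus_add : ∀ w ∈ piPlus φ ε, w + Real.pi * Complex.I ∈ logSector (φ + Real.pi) ε :=
    fun w hw => by
      simp only [piPlus, logSector, Set.mem_ofPred_eq, sec] at hw ⊢
      simp
      constructor <;> linarith
  have minus_add : ∀ w ∈ piMinus φ ε, w + Real.pi * Complex.I ∈ piPlus φ ε := fun w hw => by
    simp only [piPlus, piMinus, Set.mem_ofPred_eq, sec] at hw ⊢
    simp
    constructor <;> linarith
  have dual : ∀ τ ∈ B, ∀ w ∈ logSector (φ + Real.pi) ε, ∀ i j,
      Q.pairing (Y i τ (w - Real.pi * Complex.I)) (Ym j τ w) = if i = j then 1 else 0 :=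
    fun τ hτ w hw i j => hY.pairing_opposite hYm hBo hBc hε hΨ hτ hw i j
  set w₀ : ℂ := ((φ + Real.pi / 2 : ℝ) : ℂ) * Complex.I with hw₀
  have hw₀P : w₀ ∈ piPlus φ ε := by
    simp only [piPlus, Set.mem_ofPred_eq, sec, hw₀, Complex.im_ofReal_mul, Complex.I_im]
    constructor <;> linarith
  -- `S` is introduced as a Gram matrix at one point; that it solves `Y = Y⁻ S` comes from duality.
  set S : Matrix (Fin N) (Fin N) ℂ := Matrix.of fun i j => Q.bracket (Y i) (Y j) τ₀ w₀
  have hbr : ∀ τ ∈ B, ∀ w ∈ piPlus φ ε, ∀ i j, S i j = Q.bracket (Y i) (Y j) τ w :=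
    fun τ hτ w hw i j => hY.pairing_const hY hBo hBc (isOpen_strip _ _)
      (isPreconnected_strip _ _) plus_sub plus_Y i j hτ₀ hτ hw₀P hw
  -- the inverse matrix
  have hinv : ∀ τ ∈ B, ∀ w ∈ piPlus φ ε, (Matrix.of fun i j =>
      Q.pairing (Ym i τ (w + Real.pi * Complex.I)) (Ym j τ w)) * S = 1 := by
    intro τ hτ w hw
    ext i j
    have hexp : Y j τ w = ∑ k, S k j • Ym k τ w :=
      (Q.eq_sum_smul_iff (hY.independent τ hτ _ (plus_sub w hw))
        (fun i k => dual τ hτ w (plus_Ym w hw) i k) _ (fun k => S k j)).2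
        fun i => hbr τ hτ w hw i j
    -- Duality one half-turn further on: pairing the expansion of `yⱼ(z)` with `yᵢ⁻(e^{πi} z)` gives
    -- the `(i, j)` entry of the product.
    have h := dual τ hτ _ (plus_add w hw) j i
    rw [add_sub_cancel_right, hexp, Q.pairing_symm] at h
    rw [Matrix.mul_apply, Matrix.one_apply]
    simp only [map_sum, map_smul, smul_eq_mul] at h
    simp only [Matrix.of_apply]
    rw [Finset.sum_congr rfl fun k _ => mul_comm _ _, h]
    simp only [eq_comm]
  -- asymptotics along the central ray of `Π₊`
  have hray : ∀ τ ∈ B, ∀ i j, ∀ t : ℝ,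
      Q.pairing (Y i τ (-(t : ℂ) + (φ + Real.pi / 2 : ℝ) * Complex.I - Real.pi * Complex.I))
        (Y j τ (-(t : ℂ) + (φ + Real.pi / 2 : ℝ) * Complex.I)) = S i j := by
    intro τ hτ i j t
    refine (hbr τ hτ _ ?_ i j).symm
    simp only [piPlus, Set.mem_ofPred_eq, Complex.add_im, Complex.neg_im, Complex.ofReal_im,
      neg_zero, zero_add, Complex.im_ofReal_mul, Complex.I_im, mul_one, sub_self, abs_zero]
    exact hε
  have hθ₁ : |φ + Real.pi / 2 - Real.pi - φ| < Real.pi / 2 + ε := by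
    rw [abs_lt]; constructor <;> linarith
  have hθ₂ : |φ + Real.pi / 2 - φ| < Real.pi / 2 + ε := by
    rw [abs_lt]; constructor <;> linarith
  have heq : ∀ τ ∈ B, ∀ i j, u i τ = u j τ → S i j = if i = j then 1 else 0 :=
    fun τ hτ i j h => hY.pairing_eq_of_eigenvalue_eq hY hτ (hΨ τ hτ) hθ₁ hθ₂ (hray τ hτ i j) h
  have hdiag : ∀ i, S i i = 1 := fun i => by rw [heq τ₀ hτ₀ i i rfl, if_pos rfl]
  have hcoinc : ∀ τ ∈ B, ∀ i j, i ≠ j → u i τ = u j τ → S i j = 0 :=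
    fun τ hτ i j hij h => by rw [heq τ hτ i j h, if_neg hij]
  have hheight : ∀ τ ∈ B, ∀ i j, height φ (u i τ) < height φ (u j τ) → S i j = 0 := by
    intro τ hτ i j h
    refine hY.pairing_eq_zero_of_re_pos hY hτ (hΨ τ hτ) hθ₁ hθ₂ (hray τ hτ i j) ?_
    -- The central ray has argument `φ + π / 2`, and `Re (-i v) = Im v`, so the growth rate is the
    -- difference of heights.
    have e : (u j τ - u i τ) * Complex.exp (-((φ + Real.pi / 2 : ℝ) * Complex.I))
        = -Complex.I * (Complex.exp (-(φ * Complex.I)) * u j τ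
          - Complex.exp (-(φ * Complex.I)) * u i τ) := by
      have : -(((φ + Real.pi / 2 : ℝ) : ℂ) * Complex.I)
          = -(φ * Complex.I) + -(Real.pi / 2 * Complex.I) := by push_cast; ring
      rw [this, Complex.exp_add, Complex.exp_neg (Real.pi / 2 * Complex.I),
        Complex.exp_pi_div_two_mul_I, Complex.inv_I]
      ring
    rw [e]
    simp only [neg_mul, Complex.neg_re, Complex.I_mul_re, neg_neg, Complex.sub_im]
    exact sub_pos.2 h
  have htri : ∀ σ : Equiv.Perm (Fin N), Antitone (fun k => height φ (u (σ k) τ₀)) →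
      IsUniUpperTriangular (S.submatrix σ σ) := by
    refine fun σ hσ => ⟨fun i => hdiag _, fun i j hij => ?_⟩
    rcases (hσ hij.le).lt_or_eq with h | h
    · exact hheight τ₀ hτ₀ _ _ h
    · exact hcoinc τ₀ hτ₀ _ _ (σ.injective.ne hij.ne')
        (eq_of_height_eq_of_isAdmissible hφ (i := σ i) (j := σ j) h)
  refine ⟨S, S.transpose, ?_, ?_, fun i j => rfl, hbr, ?_, ?_, hdiag, hcoinc, hheight, ?_⟩
  · intro τ hτ T
    have hiff : ∀ w ∈ piPlus φ ε, ∀ j, Y j τ w = ∑ k, T k j • Ym k τ w ↔ ∀ i, T i j = S i j := by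
      intro w hw j
      rw [Q.eq_sum_smul_iff (hY.independent τ hτ _ (plus_sub w hw))
        (fun i k => dual τ hτ w (plus_Ym w hw) i k) _ (fun k => T k j)]
      exact forall_congr' fun i => by rw [hbr τ hτ w hw i j]; rfl
    constructor
    · intro h
      ext i j
      exact (hiff w₀ hw₀P j).1 (h w₀ hw₀P j) i
    · rintro rfl w hw j
      exact (hiff w hw j).2 fun i => rfl
  · intro τ hτ T
    have hiff : ∀ w ∈ piMinus φ ε, ∀ j,
        Y j τ w = ∑ k, T k j • Ym k τ (w + 2 * Real.pi * Complex.I) ↔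
          ∀ i, T i j = S.transpose i j := by
      intro w hw j
      -- The frame dual to `Y⁻(e^{2πi} z)` is `Y(e^{πi} z)`, with `e^{πi} z` in `Π₊`. The
      -- coefficients are `(yᵢ(e^{πi} z), yⱼ(z))`, which is `[yⱼ, yᵢ)` by symmetry: hence the
      -- transpose.
      have hw' := minus_add w hw
      have e : w + 2 * Real.pi * Complex.I
          = w + Real.pi * Complex.I + Real.pi * Complex.I := by ring
      rw [e, Q.eq_sum_smul_iff (hY.independent τ hτ _ (plus_Y _ hw'))
        (fun i k => by simpa using dual τ hτ _ (plus_add _ hw') i k) _ (fun k => T k j)]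
      refine forall_congr' fun i => ?_
      rw [Matrix.transpose_apply, hbr τ hτ _ hw' j i, FrobeniusManifold.bracket,
        add_sub_cancel_right, Q.pairing_symm]
    have hw₁ : w₀ - Real.pi * Complex.I ∈ piMinus φ ε := by
      simp only [piPlus, piMinus, Set.mem_ofPred_eq, sec] at hw₀P ⊢
      simp only [Complex.sub_im, Complex.im_ofReal_mul, Complex.I_im, mul_one]
      constructor <;> linarith
    constructor
    · intro h
      ext i j
      exact (hiff _ hw₁ j).1 (h _ hw₁ j) i
    · rintro rfl w hw j
      exact (hiff w hw j).2 fun i => rfl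
  · exact IsUnit.of_mul_eq_one_right _ (hinv τ₀ hτ₀ w₀ hw₀P)
  · intro τ hτ w hw i j
    rw [Matrix.inv_eq_left_inv (hinv τ hτ w hw), Matrix.of_apply]
  · intro σ hσ
    refine ⟨htri σ hσ, fun τ hτ w hw => ?_⟩
    have e : (Matrix.of fun k l => Q.bracket (Y (σ k)) (Y (σ l)) τ w) = S.submatrix σ σ := by
      ext k l
      exact (hbr τ hτ w hw _ _).symm
    rw [e]
    exact htri σ hσ
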